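/- Notation. For a bounded domain (non-empty connected open set) $\Omega\subset\mathbb C^d$, let $K_\Omega$ be the Kobayashi distance, $k_\Omega(x;v)$ the Kobayashi–Royden metric (both normalized so that $k_\Delta(0;v)=|v|$ on the unit disc $\Delta$), $\delta_\Omega(x)$ the Euclidean distance from $x$ to $\partial\Omega$, and $M_\Omega(r)=\sup\{1/k_\Omega(x;v): x\in\Omega,\ \delta_\Omega(x)\le r,\ \|v\|=1\}$. The bounded domain $\Omega$ is a *Goldilocks domain* if (1) $\int_0^\varepsilon \frac1r M_\Omega(r)\,dr<\infty$ for some $\varepsilon>0$, and (2) for each $x_0\in\Omega$ there are $C,\alpha>0$ with $K_\Omega(x_0,x)\le C+\alpha\log\frac1{\delta_\Omega(x)}$ for all $x\in\Omega$. A map $F:(X,d_X)\to(Y,d_Y)$ is a *quasi-isometric embedding* if there are $\lambda\ge1$, $\kappa\ge0$ with $\frac1\lambda d_Y(F(x_1),F(x_2))-\kappa\le d_X(x_1,x_2)\le\lambda d_Y(F(x_1),F(x_2))+\kappa$ for all $x_1,x_2\in X$. A *compactification* of a metric space $(X,d)$ is a pair $(\iota,X^*)$ where $X^*$ is a sequentially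 compact Hausdorff space and $\iota:X\to X^*$ is a homeomorphism onto an open dense subset of $X^*$. A compactification of a geodesic metric space $(X,d)$ is *good* if for all geodesics $\sigma_n:[a_n,b_n]\to X$ such that $\iota(\sigma_n(a_n))$ and $\iota(\sigma_n(b_n))$ converge to the same point of $X^*\setminus\iota(X)$ one has $\liminf_{n\to\infty}d(o,\sigma_n([a_n,b_n]))=\infty$ for every $o\in X$. Theorem. Let $D\subset\mathbb C^k$ be a bounded domain, let $\Omega\subset\mathbb C^d$ be a Goldilocks domain, and let $F:(D,K_D)\to(\Omega,K_\Omega)$ be a continuous quasi-isometric embedding. (a) Suppose that $(D,K_D)$ is geodesic and that $(\iota,D^*)$ is a good compactification of it whose space $D^*$ is Fréchet–Urysohn (every point of the closure of a subset is the limit of a sequence in that subset; for instance, $D^*$ is first countable or metrizable). Then there is a continuous map $\widetilde F:D^*\to\overline\Omega$ with $\widetilde F\circ\iota=F$. (b) Suppose that $(D,K_D)$ is a proper geodesic Gromov hyperbolic metric space, with Gromov boundary $D(\infty)$. Then there is a continuous map $\widetilde F:D\cup D(\infty)\to\overline\Omega$ with $\widetilde F|_D=F$, where $D\cup D(\infty)$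 is the Gromov compactification of $(D,K_D)$. -/

import Mathlib

open Filter Topology Set
open scoped ENNReal

noncomputable section

/-! ### Metric notions

Distances are those of an extended pseudometric space, because this is the structure that the
Kobayashi distance carries on an arbitrary open set. On a bounded domain it is finite and separates
points. -/

section Metric

variable {X Y : Type*}

/-- The distance as a real number. -/
def rdist [PseudoEMetricSpace X] (x y : X) : ℝ := (edist x y).toReal

/-- `F` is a `(lam, kap)`-quasi-isometric embedding for some `lam ≥ 1` and `kap ≥ 0`. -/
def IsQuasiIsometricEmbedding [PseudoEMetricSpace X] [PseudoEMetricSpace Y] (F : X → Y) : Prop :=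
  ∃ lam kap : ℝ, 1 ≤ lam ∧ 0 ≤ kap ∧ ∀ x₁ x₂ : X,
    1 / lam * rdist (F x₁) (F x₂) - kap ≤ rdist x₁ x₂ ∧
      rdist x₁ x₂ ≤ lam * rdist (F x₁) (F x₂) + kap

/-- The restriction of `σ` to `[a, b]` is a geodesic. -/
def IsGeodesicOn [PseudoEMetricSpace X] (σ : ℝ → X) (a b : ℝ) : Prop :=
  ∀ s ∈ Icc a b, ∀ t ∈ Icc a b, edist (σ s) (σ t) = ENNReal.ofReal |t - s|

/-- Any two points are joined by a geodesic. -/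
def IsGeodesicSpace (X : Type*) [PseudoEMetricSpace X] : Prop :=
  ∀ x y : X, ∃ (T : ℝ) (σ : ℝ → X), 0 ≤ T ∧ IsGeodesicOn σ 0 T ∧ σ 0 = x ∧ σ T = y

/-- Closed balls of finite radius are compact. -/
def IsProperMetric (X : Type*) [PseudoEMetricSpace X] : Prop :=
  ∀ (x : X) (r : ℝ), IsCompact {y : X | edist y x ≤ ENNReal.ofReal r}

/-- `(ι, Y)` is a compactification of `X`. -/
structure IsCompactification [TopologicalSpace X] [TopologicalSpace Y] (ι : X → Y) : Prop where
  t2Space : T2Space Y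
  seqCompactSpace : SeqCompactSpace Y
  isOpenEmbedding : IsOpenEmbedding ι
  denseRange : DenseRange ι

/-- `(ι, Y)` is a good compactification of the geodesic metric space `X`: geodesics whose two
endpoints converge to one and the same point of `Y \ ι(X)` leave every bounded set. -/
structure IsGoodCompactification [PseudoEMetricSpace X] [TopologicalSpace Y] (ι : X → Y) : Prop
    extends IsCompactification ι where
  isGeodesicSpace : IsGeodesicSpace X
  liminf_eq_top : ∀ (a b : ℕ → ℝ) (σ : ℕ → ℝ → X), (∀ n, a n ≤ b n) →
    (∀ n, IsGeodesicOn (σ n) (a n) (b n)) → ∀ ξ : Y, ξ ∉ range ι →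
    Tendsto (fun n => ι (σ n (a n))) atTop (𝓝 ξ) →
    Tendsto (fun n => ι (σ n (b n))) atTop (𝓝 ξ) →
    ∀ o : X, liminf (fun n => Metric.infEDist o (σ n '' Icc (a n) (b n))) atTop = ⊤

/-! ### The Gromov compactification -/

/-- The Gromov product `(x|y)_o`. -/
def gromovProduct [PseudoEMetricSpace X] (o x y : X) : ℝ :=
  (rdist x o + rdist o y - rdist x y) / 2

/-- Gromov hyperbolicity (four-point condition). -/
def IsGromovHyperbolic (X : Type*) [PseudoEMetricSpace X] : Prop :=
  ∃ δ : ℝ, 0 ≤ δ ∧ ∀ o x y z : X,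
    min (gromovProduct o x y) (gromovProduct o y z) - δ ≤ gromovProduct o x z

/-- `liminf_{n,m → ∞} (xₙ|yₘ)_o`. -/
def gromovLiminf [PseudoEMetricSpace X] (o : X) (x y : ℕ → X) : ℝ≥0∞ :=
  liminf (fun p : ℕ × ℕ => ENNReal.ofReal (gromovProduct o (x p.1) (y p.2))) atTop

/-- The sequence `x` converges at infinity. -/
def ConvergesAtInfinity [PseudoEMetricSpace X] (x : ℕ → X) : Prop :=
  ∀ o : X, gromovLiminf o x x = ⊤

/-- The Gromov boundary `X(∞)`: sequences converging at infinity, modulo `(xₙ|yₘ)_o → ∞`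
(an equivalence relation whenever `X` is Gromov hyperbolic). -/
def GromovBoundary (X : Type*) [PseudoEMetricSpace X] : Type _ :=
  Quot fun x y : {x : ℕ → X // ConvergesAtInfinity x} => ∀ o : X, gromovLiminf o x.1 y.1 = ⊤

/-- The set `X ∪ X(∞)`. -/
inductive GromovCompactification (X : Type*) [PseudoEMetricSpace X]
  | point (x : X) : GromovCompactification X
  | boundary (ξ : GromovBoundary X) : GromovCompactification X

/-- The sequences that represent a point of `X ∪ X(∞)`: the constant one for a point of `X`, the
members of the equivalence class for a point of `X(∞)`. -/
def GromovCompactification.reps [PseudoEMetricSpace X] :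
    GromovCompactification X → Set (ℕ → X)
  | .point x => {fun _ => x}
  | .boundary ξ => {x | ∃ h : ConvergesAtInfinity x, Quot.mk _ ⟨x, h⟩ = ξ}

/-- The Gromov product extended to `X ∪ X(∞)`. -/
def GromovCompactification.product [PseudoEMetricSpace X] (o : X)
    (p q : GromovCompactification X) : ℝ≥0∞ :=
  ⨆ x ∈ p.reps, ⨆ y ∈ q.reps, gromovLiminf o x y

/-- The topology of `X ∪ X(∞)`: `X` is open and carries its own topology, and the sets
`{p | (p|ξ)_o > R}`, `R > 0`, are a basis of neighbourhoods of `ξ ∈ X(∞)`. -/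
instance [PseudoEMetricSpace X] : TopologicalSpace (GromovCompactification X) where
  IsOpen U := IsOpen {x : X | .point x ∈ U} ∧
    ∀ ξ : GromovBoundary X, .boundary ξ ∈ U → ∀ o : X, ∃ R : ℝ,
      {p | ENNReal.ofReal R < GromovCompactification.product o p (.boundary ξ)} ⊆ U
  isOpen_univ := ⟨by simp, fun _ _ _ => ⟨0, subset_univ _⟩⟩
  isOpen_inter := by
    rintro U V ⟨hU, hU'⟩ ⟨hV, hV'⟩
    refine ⟨hU.inter hV, fun ξ hξ o => ?_⟩
    obtain ⟨R, hR⟩ := hU' ξ hξ.1 o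
    obtain ⟨S, hS⟩ := hV' ξ hξ.2 o
    refine ⟨max R S, fun p hp => ⟨hR ?_, hS ?_⟩⟩
    · exact lt_of_le_of_lt (ENNReal.ofReal_le_ofReal (le_max_left R S)) hp
    · exact lt_of_le_of_lt (ENNReal.ofReal_le_ofReal (le_max_right R S)) hp
  isOpen_sUnion := by
    intro S hS
    refine ⟨?_, fun ξ hξ o => ?_⟩
    · have : {x : X | GromovCompactification.point x ∈ ⋃₀ S}
          = ⋃ U ∈ S, {x : X | GromovCompactification.point x ∈ U} := by
        ext x; simp
      rw [this]
      exact isOpen_biUnion fun U hU => (hS U hU).1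
    · obtain ⟨U, hU, hξU⟩ := hξ
      obtain ⟨R, hR⟩ := (hS U hU).2 ξ hξU o
      exact ⟨R, hR.trans (subset_sUnion_of_mem hU)⟩

end Metric

/-! ### The Kobayashi distance and the Kobayashi-Royden metric -/

section Kobayashi

variable {d : ℕ}

/-- A bounded domain: a bounded, non-empty, connected open set. -/
structure IsBoundedDomain (Ω : Set (EuclideanSpace ℂ (Fin d))) : Prop where
  isOpen : IsOpen Ω
  isConnected : IsConnected Ω
  isBounded : Bornology.IsBounded Ω

/-- The Poincaré distance of the unit disc, `tanh⁻¹ |(a - b) / (1 - conj a * b)|`. -/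
def poincareDist (a b : ℂ) : ℝ :=
  Real.artanh (‖a - b‖ / ‖1 - (starRingEnd ℂ) a * b‖)

/-- `φ` is a holomorphic map from the open unit disc to `Ω`. -/
def IsHolomorphicDisc (Ω : Set (EuclideanSpace ℂ (Fin d)))
    (φ : ℂ → EuclideanSpace ℂ (Fin d)) : Prop :=
  DifferentiableOn ℂ φ (Metric.ball 0 1) ∧ MapsTo φ (Metric.ball 0 1) Ω

/-- `IsAnalyticChain Ω x y r`: finitely many holomorphic discs in `Ω`, joined end to end, connect `x`
to `y`, and the sum of the Poincaré distances of the pairs of parameters used is `r`. -/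
inductive IsAnalyticChain (Ω : Set (EuclideanSpace ℂ (Fin d))) :
    EuclideanSpace ℂ (Fin d) → EuclideanSpace ℂ (Fin d) → ℝ → Prop
  | disc (φ : ℂ → EuclideanSpace ℂ (Fin d)) (a b : ℂ) (hφ : IsHolomorphicDisc Ω φ)
      (ha : a ∈ Metric.ball (0 : ℂ) 1) (hb : b ∈ Metric.ball (0 : ℂ) 1) :
      IsAnalyticChain Ω (φ a) (φ b) (poincareDist a b)
  | trans (x y z : EuclideanSpace ℂ (Fin d)) (r s : ℝ) (h₁ : IsAnalyticChain Ω x y r)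
      (h₂ : IsAnalyticChain Ω y z s) : IsAnalyticChain Ω x z (r + s)

/-- The set `Ω`, to be equipped with the Kobayashi distance. -/
structure KobayashiSpace (Ω : Set (EuclideanSpace ℂ (Fin d))) where
  point : EuclideanSpace ℂ (Fin d)
  mem : point ∈ Ω

theorem poincareDist_comm (a b : ℂ) : poincareDist a b = poincareDist b a := by
  have h : ‖1 - (starRingEnd ℂ) a * b‖ = ‖1 - (starRingEnd ℂ) b * a‖ := by
    rw [← Complex.norm_conj]
    simp [mul_comm]
  rw [poincareDist, poincareDist, h, norm_sub_rev]

theorem IsAnalyticChain.symm {Ω : Set (EuclideanSpace ℂ (Fin d))}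
    {x y : EuclideanSpace ℂ (Fin d)} {r : ℝ} (h : IsAnalyticChain Ω x y r) :
    IsAnalyticChain Ω y x r := by
  induction h with
  | disc φ a b hφ ha hb =>
    rw [poincareDist_comm]
    exact .disc φ b a hφ hb ha
  | trans x y z r s _ _ h₁ h₂ =>
    rw [add_comm]
    exact .trans z y x s r h₂ h₁

/-- The Kobayashi (pseudo)distance of `Ω`: the infimum of the lengths of the analytic chains. -/
instance (Ω : Set (EuclideanSpace ℂ (Fin d))) : PseudoEMetricSpace (KobayashiSpace Ω) where
  edist x y := ⨅ (r : ℝ) (_ : IsAnalyticChain Ω x.point y.point r), ENNReal.ofReal r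
  edist_self x := by
    refine le_antisymm ?_ bot_le
    refine iInf₂_le_of_le 0 ?_ (by simp)
    have h := IsAnalyticChain.disc (Ω := Ω) (fun _ => x.point) 0 0
      ⟨differentiableOn_const _, fun _ _ => x.mem⟩ (by simp) (by simp)
    simpa [poincareDist] using h
  edist_comm x y :=
    le_antisymm (le_iInf₂ fun r h => iInf₂_le r h.symm) (le_iInf₂ fun r h => iInf₂_le r h.symm)
  edist_triangle x y z := by
    refine ENNReal.le_of_forall_pos_le_add fun ε hε hlt => ?_
    have hε' : (ε : ℝ≥0∞) / 2 ≠ 0 := by simp [hε.ne']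
    have hx := ENNReal.lt_add_right (ne_top_of_lt (lt_of_le_of_lt le_self_add hlt)) hε'
    have hy := ENNReal.lt_add_right (ne_top_of_lt (lt_of_le_of_lt le_add_self hlt)) hε'
    simp only [iInf_lt_iff] at hx hy
    obtain ⟨r, hr, hr'⟩ := hx
    obtain ⟨s, hs, hs'⟩ := hy
    refine (iInf₂_le (r + s) (.trans _ _ _ r s hr hs)).trans ?_
    refine ENNReal.ofReal_add_le.trans ((add_le_add hr'.le hs'.le).trans (le_of_eq ?_))
    rw [add_add_add_comm, ENNReal.add_halves]

/-- The Kobayashi-Royden metric `k_Ω(x; v)`: the infimum of `|α|` over the holomorphic discs `φ` in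
`Ω` with `φ 0 = x` and `α φ'(0) = v`. -/
def kobayashiRoyden (Ω : Set (EuclideanSpace ℂ (Fin d))) (x v : EuclideanSpace ℂ (Fin d)) : ℝ≥0∞ :=
  ⨅ (φ : ℂ → EuclideanSpace ℂ (Fin d)) (α : ℂ)
    (_ : IsHolomorphicDisc Ω φ ∧ φ 0 = x ∧ α • deriv φ 0 = v), ‖α‖ₑ

/-- The distance to the boundary. -/
def bdryDist (Ω : Set (EuclideanSpace ℂ (Fin d))) (x : EuclideanSpace ℂ (Fin d)) : ℝ :=
  Metric.infDist x (frontier Ω)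

/-- `M_Ω(r) = sup {1 / k_Ω(x; v) : δ_Ω(x) ≤ r, ‖v‖ = 1}`. -/
def kobayashiM (Ω : Set (EuclideanSpace ℂ (Fin d))) (r : ℝ) : ℝ≥0∞ :=
  ⨆ (x : EuclideanSpace ℂ (Fin d)) (v : EuclideanSpace ℂ (Fin d))
    (_ : x ∈ Ω ∧ bdryDist Ω x ≤ r ∧ ‖v‖ = 1), (kobayashiRoyden Ω x v)⁻¹

/-- Goldilocks domains. -/
structure IsGoldilocks (Ω : Set (EuclideanSpace ℂ (Fin d))) : Prop
    extends IsBoundedDomain Ω where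
  integral_lt_top : ∃ ε : ℝ, 0 < ε ∧
    ∫⁻ r in Ioc 0 ε, (ENNReal.ofReal r)⁻¹ * kobayashiM Ω r < ⊤
  growth : ∀ x₀ : KobayashiSpace Ω, ∃ C α : ℝ, 0 < C ∧ 0 < α ∧ ∀ x : KobayashiSpace Ω,
    rdist x₀ x ≤ C + α * Real.log (1 / bdryDist Ω x.point)

end Kobayashi

end

/-! Both parts rest on one estimate: if a geodesic of `D` stays far from a base point, `F` maps its
endpoints to points that are close in the Euclidean sense (`IsGoldilocks.edist_le_of_geodesic`).

The image is a quasi-geodesic of `Ω`; sample it at integer times. Consecutive samples are joined by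
a chain of discs of bounded length `L`. If a sample has Kobayashi distance `ρ` from the base point,
all points of its chain have distance at least `ρ - L`, so the growth condition puts them within
`exp ((C + L - ρ) / α)` of the boundary. There a unit of Kobayashi length costs at most `kobayashiM`
of that number in Euclidean length (`IsBoundedDomain.edist_point_le`). Counted from the sample
nearest to the base point, `ρ` grows at least linearly, so the arguments of `kobayashiM` decay
geometrically and the integral condition bounds the sum of all costs. Forcing `ρ ≥ R` with `R` large
makes the sum small. Working with chains of discs avoids integrating the metric along curves.

For (a), goodness sends the geodesics between two sequences with the same boundary limit to
infinity, so their images have the same limit; the Fréchet–Urysohn property turns this into a limit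
along the neighbourhood filter. For (b), a geodesic stays at least the Gromov product of its
endpoints away from the base point, so a large product forces close images. -/

/-! ### Automorphisms of the disc -/

/-- The automorphism of the unit disc that maps `0` to `a`. -/
noncomputable def discAut (a z : ℂ) : ℂ := (z + a) / (1 + (starRingEnd ℂ) a * z)

theorem one_add_conj_mul_ne_zero {a z : ℂ} (ha : ‖a‖ < 1) (hz : ‖z‖ < 1) :
    1 + (starRingEnd ℂ) a * z ≠ 0 := by
  intro h
  have h1 : (starRingEnd ℂ) a * z = -1 := by linear_combination h
  have h2 : ‖a‖ * ‖z‖ = 1 := by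
    simpa using congrArg norm h1
  nlinarith [norm_nonneg a, norm_nonneg z]

theorem discAut_zero (a : ℂ) : discAut a 0 = a := by simp [discAut]

theorem norm_discAut_lt_one {a z : ℂ} (ha : ‖a‖ < 1) (hz : ‖z‖ < 1) : ‖discAut a z‖ < 1 := by
  have hpos : 0 < ‖1 + (starRingEnd ℂ) a * z‖ := norm_pos_iff.2 (one_add_conj_mul_ne_zero ha hz)
  rw [discAut, norm_div, div_lt_one hpos]
  refine lt_of_pow_lt_pow_left₀ 2 hpos.le ?_
  have ha2 : ‖a‖ ^ 2 < 1 := by nlinarith [norm_nonneg a]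
  have hz2 : ‖z‖ ^ 2 < 1 := by nlinarith [norm_nonneg z]
  have key : ‖1 + (starRingEnd ℂ) a * z‖ ^ 2 - ‖z + a‖ ^ 2 = (1 - ‖a‖ ^ 2) * (1 - ‖z‖ ^ 2) := by
    simp only [Complex.sq_norm, Complex.normSq_apply, Complex.add_re, Complex.add_im,
      Complex.mul_re, Complex.mul_im, Complex.conj_re, Complex.conj_im, Complex.one_re,
      Complex.one_im]
    ring
  nlinarith [mul_pos (sub_pos.2 ha2) (sub_pos.2 hz2)]

theorem discAut_discAut_neg {a b : ℂ} (ha : ‖a‖ < 1) (hb : ‖b‖ < 1) :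
    discAut a (discAut (-a) b) = b := by
  have h1 : 1 + (starRingEnd ℂ) (-a) * b ≠ 0 := one_add_conj_mul_ne_zero (by simpa using ha) hb
  have h2 : 1 + (starRingEnd ℂ) a * discAut (-a) b ≠ 0 :=
    one_add_conj_mul_ne_zero ha (norm_discAut_lt_one (by simpa using ha) hb)
  have h3 : discAut (-a) b * (1 + (starRingEnd ℂ) (-a) * b) = b + -a := div_mul_cancel₀ _ h1
  rw [map_neg] at h3
  rw [discAut, div_eq_iff h2]
  linear_combination h3

/-- Moving `a` to the origin turns the quotient inside `poincareDist` into a modulus, which reduces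
estimates to radial segments. -/
theorem norm_discAut_neg (a b : ℂ) :
    ‖discAut (-a) b‖ = ‖a - b‖ / ‖1 - (starRingEnd ℂ) a * b‖ := by
  rw [discAut, norm_div, norm_sub_rev a b, map_neg, neg_mul, ← sub_eq_add_neg, ← sub_eq_add_neg]

theorem hasDerivAt_discAut {a z : ℂ} (ha : ‖a‖ < 1) (hz : ‖z‖ < 1) :
    HasDerivAt (discAut a)
      ((1 * (1 + (starRingEnd ℂ) a * z) - (z + a) * ((starRingEnd ℂ) a * 1)) /
        (1 + (starRingEnd ℂ) a * z) ^ 2) z := by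
  have h1 : HasDerivAt (fun z : ℂ => z + a) 1 z := (hasDerivAt_id z).add_const a
  have h2 : HasDerivAt (fun z : ℂ => 1 + (starRingEnd ℂ) a * z) ((starRingEnd ℂ) a * 1) z :=
    ((hasDerivAt_id z).const_mul _).const_add 1
  exact h1.div h2 (one_add_conj_mul_ne_zero ha hz)

theorem hasDerivAt_discAut_zero {a : ℂ} (ha : ‖a‖ < 1) :
    HasDerivAt (discAut a) ((1 - ‖a‖ ^ 2 : ℝ) : ℂ) 0 := by
  convert hasDerivAt_discAut ha (z := 0) (by simp) using 1
  push_cast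
  rw [← Complex.mul_conj']
  simp

theorem hasDerivAt_artanh {x : ℝ} (hx : x ∈ Ioo (-1 : ℝ) 1) :
    HasDerivAt Real.artanh (1 / (1 - x ^ 2)) x := by
  have h1 : (1 : ℝ) + x ≠ 0 := by linarith [hx.1]
  have h2 : (1 : ℝ) - x ≠ 0 := by linarith [hx.2]
  have hd : HasDerivAt (fun y : ℝ => 1 / 2 * (Real.log (1 + y) - Real.log (1 - y)))
      (1 / 2 * (1 / (1 + x) - -1 / (1 - x))) x :=
    ((((hasDerivAt_id x).const_add 1).log h1).sub
      (((hasDerivAt_id x).const_sub 1).log h2)).const_mul _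
  have he : Real.artanh =ᶠ[𝓝 x] fun y : ℝ => 1 / 2 * (Real.log (1 + y) - Real.log (1 - y)) := by
    filter_upwards [Ioo_mem_nhds hx.1 hx.2] with y hy
    rw [Real.artanh_eq_half_log ⟨hy.1.le, hy.2.le⟩,
      Real.log_div (by linarith [hy.1]) (by linarith [hy.2])]
  have h3 : 1 / (1 - x ^ 2) = 1 / 2 * (1 / (1 + x) - -1 / (1 - x)) := by
    rw [show (1 : ℝ) - x ^ 2 = (1 + x) * (1 - x) by ring]
    field_simp
    ring
  rw [h3]
  exact hd.congr_of_eventuallyEq he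

/-! ### Holomorphic discs -/

section

variable {d : ℕ} {Ω : Set (EuclideanSpace ℂ (Fin d))}

theorem IsHolomorphicDisc.comp_discAut {φ : ℂ → EuclideanSpace ℂ (Fin d)}
    (hφ : IsHolomorphicDisc Ω φ) {a : ℂ} (ha : ‖a‖ < 1) :
    IsHolomorphicDisc Ω (φ ∘ discAut a) := by
  have hm : MapsTo (discAut a) (Metric.ball 0 1) (Metric.ball 0 1) := fun z hz => by
    simp only [mem_ball_zero_iff] at hz ⊢
    exact norm_discAut_lt_one ha hz
  refine ⟨hφ.1.comp (fun z hz => ?_) hm, hφ.2.comp hm⟩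
  exact (hasDerivAt_discAut ha (mem_ball_zero_iff.1 hz)).differentiableAt.differentiableWithinAt

theorem IsHolomorphicDisc.differentiableAt {φ : ℂ → EuclideanSpace ℂ (Fin d)}
    (hφ : IsHolomorphicDisc Ω φ) {z : ℂ} (hz : ‖z‖ < 1) : DifferentiableAt ℂ φ z :=
  hφ.1.differentiableAt (Metric.isOpen_ball.mem_nhds (mem_ball_zero_iff.2 hz))

theorem IsHolomorphicDisc.mem {φ : ℂ → EuclideanSpace ℂ (Fin d)}
    (hφ : IsHolomorphicDisc Ω φ) {z : ℂ} (hz : ‖z‖ < 1) : φ z ∈ Ω :=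
  hφ.2 (mem_ball_zero_iff.2 hz)

/-- If `φ'(0) ≠ 0`, the disc `φ` itself competes for `k(φ 0; v)` in the normalized direction `v` of
`φ'(0)`, with value `1 / ‖φ'(0)‖`. -/
theorem IsHolomorphicDisc.norm_deriv_zero_le {φ : ℂ → EuclideanSpace ℂ (Fin d)}
    (hφ : IsHolomorphicDisc Ω φ) {c : ℝ} (hc : 0 ≤ c)
    (hk : ∀ v : EuclideanSpace ℂ (Fin d), ‖v‖ = 1 →
      (kobayashiRoyden Ω (φ 0) v)⁻¹ ≤ ENNReal.ofReal c) : ‖deriv φ 0‖ ≤ c := by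
  rcases eq_or_ne (deriv φ 0) 0 with h0 | h0
  · simpa [h0] using hc
  have hpos : 0 < ‖deriv φ 0‖ := norm_pos_iff.2 h0
  set α : ℂ := ((‖deriv φ 0‖⁻¹ : ℝ) : ℂ)
  have hα : ‖α‖ = ‖deriv φ 0‖⁻¹ := by simp [α]
  have hv : ‖α • deriv φ 0‖ = 1 := by
    rw [norm_smul, hα, inv_mul_cancel₀ hpos.ne']
  have hle : kobayashiRoyden Ω (φ 0) (α • deriv φ 0) ≤ ‖α‖ₑ :=
    iInf₂_le_of_le φ α (iInf_le _ ⟨hφ, rfl, rfl⟩)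
  have h1 := (ENNReal.inv_le_inv.2 hle).trans (hk _ hv)
  rw [← ofReal_norm, hα, ← ENNReal.ofReal_inv_of_pos (inv_pos.2 hpos), inv_inv] at h1
  exact (ENNReal.ofReal_le_ofReal_iff hc).1 h1

theorem IsHolomorphicDisc.norm_deriv_le {φ : ℂ → EuclideanSpace ℂ (Fin d)}
    (hφ : IsHolomorphicDisc Ω φ) {c : ℝ} (hc : 0 ≤ c) {z : ℂ} (hz : ‖z‖ < 1)
    (hk : ∀ v : EuclideanSpace ℂ (Fin d), ‖v‖ = 1 →
      (kobayashiRoyden Ω (φ z) v)⁻¹ ≤ ENNReal.ofReal c) :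
    ‖deriv φ z‖ ≤ c * (1 / (1 - ‖z‖ ^ 2)) := by
  have h1 : HasDerivAt (φ ∘ discAut z) (((1 - ‖z‖ ^ 2 : ℝ) : ℂ) • deriv φ z) 0 := by
    refine HasDerivAt.scomp (h := discAut z) 0 ?_ (hasDerivAt_discAut_zero hz)
    rw [discAut_zero]
    exact (hφ.differentiableAt hz).hasDerivAt
  have h2 := (hφ.comp_discAut hz).norm_deriv_zero_le hc (by
    simpa only [Function.comp_apply, discAut_zero] using hk)
  have hpos : 0 < 1 - ‖z‖ ^ 2 := by nlinarith [norm_nonneg z]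
  rw [h1.deriv, norm_smul, Complex.norm_real, Real.norm_of_nonneg hpos.le] at h2
  rw [mul_one_div, le_div_iff₀ hpos]
  linarith

theorem poincareDist_nonneg (a b : ℂ) : 0 ≤ poincareDist a b :=
  Real.artanh_nonneg (by positivity)

/-- After an automorphism moves `a` to `0`, the derivative bound is integrated along the radius to
the image of `b`, with `c * artanh` as comparison function. The radius stays in the Poincaré ball
about `a` through `b`, so the bound is only needed there. -/
theorem IsHolomorphicDisc.norm_sub_le {φ : ℂ → EuclideanSpace ℂ (Fin d)}
    (hφ : IsHolomorphicDisc Ω φ) {a b : ℂ} (ha : ‖a‖ < 1) (hb : ‖b‖ < 1) {c : ℝ} (hc : 0 ≤ c)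
    (hk : ∀ w, ‖w‖ < 1 → poincareDist a w ≤ poincareDist a b →
      ∀ v : EuclideanSpace ℂ (Fin d), ‖v‖ = 1 →
        (kobayashiRoyden Ω (φ w) v)⁻¹ ≤ ENNReal.ofReal c) :
    ‖φ b - φ a‖ ≤ c * poincareDist a b := by
  have hna : ‖-a‖ < 1 := by simpa using ha
  set e := discAut (-a) b with he
  have he1 : ‖e‖ < 1 := norm_discAut_lt_one hna hb
  have hpe : poincareDist a b = Real.artanh ‖e‖ := by
    rw [he, norm_discAut_neg, poincareDist]
  set ψ := φ ∘ discAut a with hψ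
  have hψd : IsHolomorphicDisc Ω ψ := hφ.comp_discAut ha
  have hψ0 : ψ 0 = φ a := by simp [hψ, discAut_zero]
  have hψe : ψ e = φ b := by simp [hψ, he, discAut_discAut_neg ha hb]
  have hnorm : ∀ t ∈ Icc (0 : ℝ) 1, ‖(t : ℂ) * e‖ = t * ‖e‖ := fun t ht => by
    rw [norm_mul, Complex.norm_real, Real.norm_of_nonneg ht.1]
  have hlt : ∀ t ∈ Icc (0 : ℝ) 1, t * ‖e‖ < 1 := fun t ht => by
    nlinarith [ht.1, ht.2, norm_nonneg e]
  have hder : ∀ t ∈ Icc (0 : ℝ) 1,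
      HasDerivAt (fun t : ℝ => ψ ((t : ℂ) * e) - ψ 0) (e • deriv ψ ((t : ℂ) * e)) t := by
    intro t ht
    have h1 : HasDerivAt ψ (deriv ψ ((t : ℂ) * e)) ((t : ℂ) * e) :=
      (hψd.differentiableAt (by rw [hnorm t ht]; exact hlt t ht)).hasDerivAt
    have h2 : HasDerivAt (fun t : ℝ => (t : ℂ) * e) e t := by
      simpa using (Complex.ofRealCLM.hasDerivAt (x := t)).mul_const e
    exact (h1.scomp t h2).sub_const _
  have hB : ∀ t ∈ Icc (0 : ℝ) 1, HasDerivAt (fun t : ℝ => c * Real.artanh (t * ‖e‖))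
      (c * (1 / (1 - (t * ‖e‖) ^ 2) * ‖e‖)) t := by
    intro t ht
    have hm : t * ‖e‖ ∈ Ioo (-1 : ℝ) 1 :=
      ⟨by nlinarith [mul_nonneg ht.1 (norm_nonneg e)], hlt t ht⟩
    have h2 : HasDerivAt (fun t : ℝ => t * ‖e‖) ‖e‖ t := by
      simpa using (hasDerivAt_id t).mul_const ‖e‖
    exact ((hasDerivAt_artanh hm).comp t h2).const_mul c
  have hbound : ∀ t ∈ Ico (0 : ℝ) 1,
      ‖e • deriv ψ ((t : ℂ) * e)‖ ≤ c * (1 / (1 - (t * ‖e‖) ^ 2) * ‖e‖) := by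
    intro t ht'
    have ht : t ∈ Icc (0 : ℝ) 1 := ⟨ht'.1, ht'.2.le⟩
    have hz : ‖(t : ℂ) * e‖ < 1 := by rw [hnorm t ht]; exact hlt t ht
    have hw : ‖discAut a ((t : ℂ) * e)‖ < 1 := norm_discAut_lt_one ha hz
    have hpw : poincareDist a (discAut a ((t : ℂ) * e)) = Real.artanh (t * ‖e‖) := by
      rw [poincareDist, ← norm_discAut_neg, ← hnorm t ht]
      have := discAut_discAut_neg hna hz
      rw [neg_neg] at this
      rw [this]
    have h3 := hψd.norm_deriv_le hc hz (hk _ hw (by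
      rw [hpw, hpe]
      refine Real.artanh_le_artanh ?_ he1 ?_
      · nlinarith [mul_nonneg ht.1 (norm_nonneg e)]
      · nlinarith [ht.2, norm_nonneg e]))
    rw [hnorm t ht] at h3
    rw [norm_smul]
    nlinarith [mul_le_mul_of_nonneg_left h3 (norm_nonneg e)]
  have := image_norm_le_of_norm_deriv_right_le_deriv_boundary'
    (f := fun t : ℝ => ψ ((t : ℂ) * e) - ψ 0)
    (fun t ht => (hder t ht).continuousAt.continuousWithinAt)
    (fun t ht => (hder t ⟨ht.1, ht.2.le⟩).hasDerivWithinAt) (by simp)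
    (fun t ht => (hB t ht).continuousAt.continuousWithinAt)
    (fun t ht => (hB t ⟨ht.1, ht.2.le⟩).hasDerivWithinAt) hbound (right_mem_Icc.2 zero_le_one)
  simpa [hψ0, hψe, hpe] using this

/-! ### Euclidean versus Kobayashi distance -/

theorem IsAnalyticChain.nonneg {x y : EuclideanSpace ℂ (Fin d)} {r : ℝ}
    (h : IsAnalyticChain Ω x y r) : 0 ≤ r := by
  induction h with
  | disc φ a b hφ ha hb => exact poincareDist_nonneg a b
  | trans x y z r s _ _ h₁ h₂ => exact add_nonneg h₁ h₂

theorem IsAnalyticChain.right_mem {x y : EuclideanSpace ℂ (Fin d)} {r : ℝ}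
    (h : IsAnalyticChain Ω x y r) : y ∈ Ω := by
  induction h with
  | disc φ a b hφ ha hb => exact hφ.2 hb
  | trans x y z r s _ _ h₁ h₂ => exact h₂

theorem KobayashiSpace.edist_le_of_chain {x y : KobayashiSpace Ω} {r : ℝ}
    (h : IsAnalyticChain Ω x.point y.point r) : edist x y ≤ ENNReal.ofReal r :=
  iInf₂_le r h

theorem KobayashiSpace.exists_chain_of_edist_lt {x y : KobayashiSpace Ω} {L : ℝ}
    (h : edist x y < ENNReal.ofReal L) : ∃ r < L, IsAnalyticChain Ω x.point y.point r := by
  change (⨅ (r : ℝ) (_ : IsAnalyticChain Ω x.point y.point r), ENNReal.ofReal r) < _ at h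
  simp only [iInf_lt_iff] at h
  obtain ⟨r, hr, hlt⟩ := h
  exact ⟨r, (ENNReal.ofReal_lt_ofReal_iff_of_nonneg hr.nonneg).1 hlt, hr⟩

/-- Only points reachable from `x` within length `r` enter `hk`. This localization lets `c` depend
on how far the chain lies from a base point. -/
theorem IsAnalyticChain.norm_sub_le {x y : EuclideanSpace ℂ (Fin d)} {r : ℝ}
    (h : IsAnalyticChain Ω x y r) {c : ℝ} (hc : 0 ≤ c)
    (hk : ∀ s w, s ≤ r → IsAnalyticChain Ω x w s → ∀ v : EuclideanSpace ℂ (Fin d), ‖v‖ = 1 →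
      (kobayashiRoyden Ω w v)⁻¹ ≤ ENNReal.ofReal c) : ‖y - x‖ ≤ c * r := by
  induction h with
  | disc φ a b hφ ha hb =>
    refine hφ.norm_sub_le (mem_ball_zero_iff.1 ha) (mem_ball_zero_iff.1 hb) hc ?_
    exact fun w hw hle => hk _ _ hle (.disc φ a w hφ ha (mem_ball_zero_iff.2 hw))
  | trans x y z r s h₁ h₂ ih₁ ih₂ =>
    have e₁ := ih₁ fun t w ht hw => hk t w (ht.trans (le_add_of_nonneg_right h₂.nonneg)) hw
    -- A point of the second part is reached from `x` by prefixing the whole first chain.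
    have e₂ := ih₂ fun t w ht hw => hk (r + t) w (by linarith) (.trans _ _ _ _ _ h₁ hw)
    calc ‖z - x‖ = ‖(z - y) + (y - x)‖ := by rw [sub_add_sub_cancel]
      _ ≤ ‖z - y‖ + ‖y - x‖ := norm_add_le _ _
      _ ≤ c * (r + s) := by linarith

/-- Cauchy's estimate on the circle of radius `1/2`, where the factor 2 comes from. It yields the
crude Lipschitz bound behind `KobayashiSpace.continuous_point`. -/
theorem inv_kobayashiRoyden_le {C : ℝ} (hC : 0 < C) (hΩ : ∀ z ∈ Ω, ‖z‖ ≤ C)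
    (x v : EuclideanSpace ℂ (Fin d)) (hv : ‖v‖ = 1) :
    (kobayashiRoyden Ω x v)⁻¹ ≤ ENNReal.ofReal (2 * C) := by
  rw [ENNReal.inv_le_iff_inv_le, ← ENNReal.ofReal_inv_of_pos (by positivity)]
  refine le_iInf₂ fun φ α => le_iInf fun ⟨hφ, _, hα⟩ => ?_
  have hd : ‖deriv φ 0‖ ≤ C / (1 / 2) := by
    refine Complex.norm_deriv_le_of_forall_mem_sphere_norm_le (by norm_num) ?_ fun z hz => ?_
    · refine DifferentiableOn.diffContOnCl (hφ.1.mono ?_)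
      rw [closure_ball _ (by norm_num)]
      exact Metric.closedBall_subset_ball (by norm_num)
    · refine hΩ _ (hφ.mem ?_)
      rw [mem_sphere_zero_iff_norm.1 hz]
      norm_num
  rw [← ofReal_norm]
  refine ENNReal.ofReal_le_ofReal ?_
  have h1 : ‖α‖ * ‖deriv φ 0‖ = 1 := by rw [← norm_smul, hα, hv]
  rw [inv_le_iff_one_le_mul₀ (by positivity)]
  nlinarith [mul_le_mul_of_nonneg_left hd (norm_nonneg α)]

theorem KobayashiSpace.ofReal_norm_sub_le {C : ℝ} (hC : 0 < C) (hΩ : ∀ z ∈ Ω, ‖z‖ ≤ C)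
    (x y : KobayashiSpace Ω) :
    ENNReal.ofReal ‖y.point - x.point‖ ≤ ENNReal.ofReal (2 * C) * edist x y := by
  rcases eq_or_ne (edist x y) ⊤ with htop | htop
  · rw [htop, ENNReal.mul_top (by simpa using hC)]
    exact le_top
  refine ENNReal.le_mul_of_forall_lt (.inr htop) (.inl ENNReal.ofReal_ne_top) fun a ha b hb => ?_
  rcases eq_or_ne b ⊤ with rfl | hbt
  · rw [ENNReal.mul_top (pos_of_gt ha).ne']
    exact le_top
  rw [← ENNReal.ofReal_toReal hbt] at hb ⊢
  obtain ⟨r, hr, h⟩ := KobayashiSpace.exists_chain_of_edist_lt hb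
  have h1 := h.norm_sub_le (c := 2 * C) (by positivity) fun _ w _ _ v hv =>
    inv_kobayashiRoyden_le hC hΩ w v hv
  refine le_trans ?_ (mul_le_mul_left ha.le _)
  rw [← ENNReal.ofReal_mul (by positivity)]
  exact ENNReal.ofReal_le_ofReal (h1.trans (mul_le_mul_of_nonneg_left hr.le (by positivity)))

theorem KobayashiSpace.continuous_point (hΩ : Bornology.IsBounded Ω) :
    Continuous (KobayashiSpace.point : KobayashiSpace Ω → EuclideanSpace ℂ (Fin d)) := by
  obtain ⟨C, hC, hb⟩ := hΩ.exists_pos_norm_le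
  have : LipschitzWith (2 * C).toNNReal
      (KobayashiSpace.point : KobayashiSpace Ω → EuclideanSpace ℂ (Fin d)) := fun x y => by
    rw [edist_comm x.point, edist_dist, dist_eq_norm]
    exact KobayashiSpace.ofReal_norm_sub_le hC hb x y
  exact this.continuous

theorem exists_chain_of_mem_ball {x y : EuclideanSpace ℂ (Fin d)} {ρ : ℝ}
    (hρ : Metric.ball x ρ ⊆ Ω) (hy : y ∈ Metric.ball x ρ) : ∃ r, IsAnalyticChain Ω x y r := by
  have hyx : ‖y - x‖ < ρ := by rwa [← dist_eq_norm]
  have hρ0 : 0 < ρ := (norm_nonneg _).trans_lt hyx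
  rcases eq_or_ne y x with rfl | hne
  · have h := IsAnalyticChain.disc (Ω := Ω) (fun _ => y) 0 0
      ⟨differentiableOn_const _, fun _ _ => hρ hy⟩ (by simp) (by simp)
    exact ⟨_, h⟩
  have hn : 0 < ‖y - x‖ := norm_pos_iff.2 (sub_ne_zero.2 hne)
  set b : ℂ := ((‖y - x‖ / ρ : ℝ) : ℂ) with hb
  set u : EuclideanSpace ℂ (Fin d) := ((ρ / ‖y - x‖ : ℝ) : ℂ) • (y - x) with hu
  have hun : ‖u‖ = ρ := by
    rw [hu, norm_smul, Complex.norm_real, Real.norm_of_nonneg (by positivity)]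
    field_simp
  have h := IsAnalyticChain.disc (Ω := Ω) (fun z : ℂ => x + z • u) 0 b
    ⟨by fun_prop, fun z hz => hρ (by
      rw [Metric.mem_ball, dist_eq_norm, add_sub_cancel_left, norm_smul, hun]
      rw [mem_ball_zero_iff] at hz
      nlinarith)⟩ (by simp)
    (by
      rw [mem_ball_zero_iff, hb, Complex.norm_real, Real.norm_of_nonneg (by positivity),
        div_lt_one hρ0]
      exact hyx)
  have hbu : x + b • u = y := by
    rw [hb, hu, smul_smul, ← Complex.ofReal_mul]
    have : ‖y - x‖ / ρ * (ρ / ‖y - x‖) = 1 := by field_simp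
    rw [this]
    simp
  simp only [hbu, zero_smul, add_zero] at h
  exact ⟨_, h⟩

/-- Affine discs link all points of a ball to its centre, so the reachable set and its complement in
`Ω` are both open. This makes the Kobayashi distance finite, as the triangle inequality for `rdist`
requires. -/
theorem exists_chain (hΩ : IsOpen Ω) (hc : IsPreconnected Ω) {x y : EuclideanSpace ℂ (Fin d)}
    (hx : x ∈ Ω) (hy : y ∈ Ω) : ∃ r, IsAnalyticChain Ω x y r := by
  have hu : IsOpen {y | ∃ r, IsAnalyticChain Ω x y r} := by
    refine Metric.isOpen_iff.2 fun z ⟨r, hr⟩ => ?_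
    obtain ⟨ρ, hρ, hs⟩ := Metric.isOpen_iff.1 hΩ z hr.right_mem
    refine ⟨ρ, hρ, fun w hw => ?_⟩
    obtain ⟨s, hs'⟩ := exists_chain_of_mem_ball hs hw
    exact ⟨_, hr.trans _ _ _ _ _ hs'⟩
  have hv : IsOpen {y | y ∈ Ω ∧ ¬∃ r, IsAnalyticChain Ω x y r} := by
    refine Metric.isOpen_iff.2 fun z hz => ?_
    obtain ⟨ρ, hρ, hs⟩ := Metric.isOpen_iff.1 hΩ z hz.1
    refine ⟨ρ, hρ, fun w hw => ⟨hs hw, fun ⟨r, hr⟩ => hz.2 ?_⟩⟩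
    obtain ⟨s, hs'⟩ := exists_chain_of_mem_ball hs hw
    exact ⟨_, hr.trans _ _ _ _ _ hs'.symm⟩
  by_contra hno
  obtain ⟨ρ, hρ, hs⟩ := Metric.isOpen_iff.1 hΩ x hx
  obtain ⟨z, -, hz1, hz2⟩ := hc _ _ hu hv
    (fun z hz => (em (∃ r, IsAnalyticChain Ω x z r)).imp id fun h => ⟨hz, h⟩)
    ⟨x, hx, exists_chain_of_mem_ball hs (Metric.mem_ball_self hρ)⟩ ⟨y, hy, hy, hno⟩
  exact hz2.2 hz1

theorem IsBoundedDomain.edist_ne_top (hΩ : IsBoundedDomain Ω) (x y : KobayashiSpace Ω) :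
    edist x y ≠ ⊤ := by
  obtain ⟨r, hr⟩ := exists_chain hΩ.isOpen hΩ.isConnected.isPreconnected x.mem y.mem
  exact ((KobayashiSpace.edist_le_of_chain hr).trans_lt ENNReal.ofReal_lt_top).ne

end

/-! ### Real-valued distances -/

section

variable {X : Type*} [PseudoEMetricSpace X]

theorem rdist_comm (x y : X) : rdist x y = rdist y x := by rw [rdist, rdist, edist_comm]

theorem rdist_triangle (hX : ∀ x y : X, edist x y ≠ ⊤) (x y z : X) :
    rdist x z ≤ rdist x y + rdist y z := by
  rw [rdist, rdist, rdist, ← ENNReal.toReal_add (hX _ _) (hX _ _)]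
  exact ENNReal.toReal_mono (ENNReal.add_ne_top.2 ⟨hX _ _, hX _ _⟩) (edist_triangle x y z)

theorem IsGeodesicOn.rdist_eq {σ : ℝ → X} {a b : ℝ} (h : IsGeodesicOn σ a b) {s t : ℝ}
    (hs : s ∈ Icc a b) (ht : t ∈ Icc a b) : rdist (σ s) (σ t) = |t - s| := by
  rw [rdist, h s hs t ht, ENNReal.toReal_ofReal (abs_nonneg _)]

theorem IsGeodesicSpace.edist_ne_top (h : IsGeodesicSpace X) (x y : X) : edist x y ≠ ⊤ := by
  obtain ⟨T, σ, hT, hσ, rfl, rfl⟩ := h x y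
  rw [hσ 0 (left_mem_Icc.2 hT) T (right_mem_Icc.2 hT)]
  exact ENNReal.ofReal_ne_top

/-- A geodesic from `x` to `y` avoids the ball about `o` whose radius is the Gromov product. -/
theorem IsGeodesicOn.gromovProduct_le (hX : ∀ x y : X, edist x y ≠ ⊤) {σ : ℝ → X} {a b t : ℝ}
    (h : IsGeodesicOn σ a b) (ht : t ∈ Icc a b) (o : X) :
    gromovProduct o (σ a) (σ b) ≤ rdist o (σ t) := by
  have hab := ht.1.trans ht.2
  have h1 := h.rdist_eq (left_mem_Icc.2 hab) ht
  have h2 := h.rdist_eq ht (right_mem_Icc.2 hab)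
  have h3 := h.rdist_eq (left_mem_Icc.2 hab) (right_mem_Icc.2 hab)
  rw [abs_of_nonneg (by linarith [ht.1])] at h1
  rw [abs_of_nonneg (by linarith [ht.2])] at h2
  rw [abs_of_nonneg (by linarith)] at h3
  have h4 := rdist_triangle hX (σ a) (σ t) o
  have h5 := rdist_triangle hX o (σ t) (σ b)
  rw [rdist_comm (σ t) o] at h4
  rw [gromovProduct]
  linarith

end

/-! ### Sums along quasi-geodesics -/

/-- On the shell `(ε q^(i+1), ε q^i]`, of length `(1 - q) ε q^i`, the integrand is at least `M (ε
q^(i+1)) / (ε q^i)`. Each shell thus contributes at least `(1 - q) M (ε q^(i+1))`. -/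
theorem tsum_geometric_ne_top_of_lintegral {M : ℝ → ℝ≥0∞} (hM : Monotone M) {ε q : ℝ}
    (hε : 0 < ε) (hint : ∫⁻ r in Ioc 0 ε, (ENNReal.ofReal r)⁻¹ * M r ≠ ⊤) (hq : 0 < q)
    (hq1 : q < 1) : ∑' i : ℕ, M (ε * q ^ (i + 1)) ≠ ⊤ := by
  set I : ℕ → Set ℝ := fun i => Ioc (ε * q ^ (i + 1)) (ε * q ^ i) with hI
  have hanti : Antitone fun i : ℕ => ε * q ^ i := fun i j hij =>
    mul_le_mul_of_nonneg_left (pow_le_pow_of_le_one hq.le hq1.le hij) hε.le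
  have hdisj : Pairwise (Function.onFun Disjoint I) := by
    simpa [hI] using hanti.pairwise_disjoint_on_Ioc_succ
  have hsub : (⋃ i, I i) ⊆ Ioc 0 ε := iUnion_subset fun i r hr =>
    ⟨lt_trans (by positivity) hr.1, hr.2.trans (by simpa using hanti (Nat.zero_le i))⟩
  have hle : ∀ i, ENNReal.ofReal (1 - q) * M (ε * q ^ (i + 1)) ≤
      ∫⁻ r in I i, (ENNReal.ofReal r)⁻¹ * M r := by
    intro i
    have hpos : 0 < ε * q ^ i := by positivity
    calc ENNReal.ofReal (1 - q) * M (ε * q ^ (i + 1))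
        = (ENNReal.ofReal (ε * q ^ i))⁻¹ * M (ε * q ^ (i + 1)) * MeasureTheory.volume (I i) := by
          rw [hI, Real.volume_Ioc, mul_right_comm, ← ENNReal.ofReal_inv_of_pos hpos,
            ← ENNReal.ofReal_mul (by positivity)]
          congr 2
          field_simp
          ring
      _ = ∫⁻ _ in I i, (ENNReal.ofReal (ε * q ^ i))⁻¹ * M (ε * q ^ (i + 1)) := by
          rw [MeasureTheory.setLIntegral_const]
      _ ≤ _ := by
          refine MeasureTheory.setLIntegral_mono' measurableSet_Ioc fun r hr => ?_
          exact mul_le_mul' (ENNReal.inv_le_inv.2 (ENNReal.ofReal_le_ofReal hr.2)) (hM hr.1.le)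
  have hfin : ENNReal.ofReal (1 - q) * ∑' i : ℕ, M (ε * q ^ (i + 1)) < ⊤ := by
    rw [← ENNReal.tsum_mul_left]
    refine (ENNReal.tsum_le_tsum hle).trans_lt ?_
    rw [← MeasureTheory.lintegral_iUnion (fun _ => measurableSet_Ioc) hdisj]
    exact (MeasureTheory.lintegral_mono_set hsub).trans_lt hint.lt_top
  intro htop
  rw [htop, ENNReal.mul_top (by simpa using hq1)] at hfin
  exact hfin.ne rfl

theorem exists_tsum_mul_pow_ne_top {M : ℝ → ℝ≥0∞} (hM : Monotone M) {ε q : ℝ}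
    (hε : 0 < ε) (hint : ∫⁻ r in Ioc 0 ε, (ENNReal.ofReal r)⁻¹ * M r ≠ ⊤) (hq : 0 < q)
    (hq1 : q < 1) (A : ℝ) : ∃ J : ℕ, ∑' i : ℕ, M (A * q ^ (i + J)) ≠ ⊤ := by
  have hlim : Tendsto (fun J : ℕ => A * q ^ J) atTop (𝓝 (A * 0)) :=
    (tendsto_pow_atTop_nhds_zero_of_lt_one hq.le hq1).const_mul A
  rw [mul_zero] at hlim
  have hpos : 0 < ε * q := by positivity
  -- Skipping `J` terms is essential: `M` is controlled only near 0 and may be infinite at `A`.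
  obtain ⟨J, hJ⟩ := (hlim.eventually (ge_mem_nhds hpos)).exists
  refine ⟨J, ne_top_of_le_ne_top (tsum_geometric_ne_top_of_lintegral hM hε hint hq hq1) ?_⟩
  refine ENNReal.tsum_le_tsum fun i => hM ?_
  calc A * q ^ (i + J) = A * q ^ J * q ^ i := by ring
    _ ≤ ε * q * q ^ i := by gcongr
    _ = ε * q ^ (i + 1) := by ring

/-- The tail is small for every `R`; each of the finitely many other terms is at most `m R`, which
is small when `R` is a late value of `u`. -/
theorem exists_tsum_max_le {m : ℝ → ℝ≥0∞} (hm : Antitone m) {u : ℕ → ℝ} (J : ℕ)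
    (hsum : ∑' i, m (u (i + J)) ≠ ⊤) {ε : ℝ≥0∞} (hε : ε ≠ 0) :
    ∃ R : ℝ, ∑' i, m (max R (u i)) ≤ ε := by
  have hε2 : ε / 2 ≠ 0 := by simpa using hε
  obtain ⟨n, hn⟩ := ((ENNReal.tendsto_sum_nat_add _ hsum).eventually
    (ge_mem_nhds (pos_iff_ne_zero.2 hε2))).exists
  set N := n + J with hN
  have hεN : ε / 2 / (N + 1) ≠ 0 := ENNReal.div_ne_zero.2 ⟨hε2, by finiteness⟩
  obtain ⟨i, hi⟩ := ((ENNReal.tendsto_atTop_zero_of_tsum_ne_top hsum).eventually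
    (ge_mem_nhds (pos_iff_ne_zero.2 hεN))).exists
  refine ⟨u (i + J), ?_⟩
  rw [← ENNReal.summable.sum_add_tsum_nat_add' (k := N), ← ENNReal.add_halves ε]
  refine add_le_add ?_ ?_
  · calc ∑ j ∈ Finset.range N, m (max (u (i + J)) (u j))
        ≤ ∑ j ∈ Finset.range N, ε / 2 / (N + 1) :=
          Finset.sum_le_sum fun j _ => (hm (le_max_left _ _)).trans hi
      _ = N * (ε / 2 / (N + 1)) := by simp
      _ ≤ (N + 1) * (ε / 2 / (N + 1)) := by gcongr; exact le_self_add
      _ ≤ ε / 2 := ENNReal.mul_div_le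
  · refine le_trans (ENNReal.tsum_le_tsum fun j => ?_) hn
    exact hm ((le_max_right _ _).trans' (by rw [hN, add_assoc]))

/-- Let `p j₀` be the sample nearest to `o`. Then `d(pᵢ, p j₀) ≤ 2 d(o, pᵢ)`, so `d(o, pᵢ)` grows at
least linearly in `|i - j₀|`. The sum occurs twice, once for each side of `j₀`. -/
theorem edist_le_of_quasiGeodesic_seq {X E : Type*} [PseudoEMetricSpace X] [PseudoEMetricSpace E]
    (hX : ∀ x y : X, edist x y ≠ ⊤) (e : X → E) (o : X) {m : ℝ → ℝ≥0∞} (hm : Antitone m)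
    {L : ℝ} {c : ℝ≥0∞} (hstep : ∀ p q : X, rdist p q < L → edist (e p) (e q) ≤ c * m (rdist o p))
    {lam κ R : ℝ} (hlam : 0 < lam) {p : ℕ → X} {N : ℕ}
    (hlow : ∀ i ≤ N, ∀ j, i + j ≤ N → (j - κ) / lam ≤ rdist (p i) (p (i + j)))
    (hsucc : ∀ i < N, rdist (p i) (p (i + 1)) < L) (hR : ∀ i ≤ N, R ≤ rdist o (p i)) :
    edist (e (p 0)) (e (p N)) ≤ 2 * (c * ∑' i : ℕ, m (max R ((i - κ) / (2 * lam)))) := by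
  obtain ⟨j₀, hj₀, hmin⟩ := Finset.exists_min_image (Finset.range (N + 1))
    (fun j => rdist o (p j)) ⟨0, by simp⟩
  simp only [Finset.mem_range, Nat.lt_succ_iff] at hj₀ hmin
  have hhalf : ∀ i ≤ N, ∀ j : ℕ, (j - κ) / lam ≤ rdist (p i) (p j₀) →
      max R ((j - κ) / (2 * lam)) ≤ rdist o (p i) := by
    intro i hi j hij
    refine max_le (hR i hi) ?_
    have h1 := rdist_triangle hX (p i) o (p j₀)
    rw [rdist_comm (p i) o] at h1
    have h2 := hmin i hi
    have h3 : (j - κ) / (2 * lam) = (j - κ) / lam / 2 := by field_simp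
    linarith
  have hright : edist (e (p j₀)) (e (p N)) ≤
      c * ∑' i : ℕ, m (max R ((i - κ) / (2 * lam))) := by
    have := edist_le_range_sum_of_edist_le (f := fun i => e (p (j₀ + i))) (N - j₀)
      (d := fun i => c * m (max R ((i - κ) / (2 * lam)))) fun {i} hi => by
        refine (hstep _ _ (hsucc (j₀ + i) (by omega))).trans ?_
        gcongr
        refine hm (hhalf _ (by omega) _ ?_)
        rw [rdist_comm]
        exact hlow j₀ hj₀ i (by omega)
    simp only [add_zero, Nat.add_sub_cancel' hj₀] at this
    refine this.trans ?_
    rw [← ENNReal.tsum_mul_left]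
    exact ENNReal.sum_le_tsum _
  have hleft : edist (e (p j₀)) (e (p 0)) ≤
      c * ∑' i : ℕ, m (max R ((i - κ) / (2 * lam))) := by
    -- Walking backwards, each step is charged to its endpoint nearer to `j₀` in index, so this sum
    -- also starts at `i = 0`.
    have := edist_le_range_sum_of_edist_le (f := fun i => e (p (j₀ - i))) j₀
      (d := fun i => c * m (max R ((i - κ) / (2 * lam)))) fun {i} hi => by
        refine (hstep _ _ ?_).trans ?_
        · rw [rdist_comm]
          have := hsucc (j₀ - (i + 1)) (by omega)
          rwa [show j₀ - (i + 1) + 1 = j₀ - i by omega] at this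
        · gcongr
          refine hm (hhalf _ (by omega) _ ?_)
          have := hlow (j₀ - i) (by omega) i (by omega)
          rwa [show j₀ - i + i = j₀ by omega] at this
    simp only [Nat.sub_zero, Nat.sub_self] at this
    refine this.trans ?_
    rw [← ENNReal.tsum_mul_left]
    exact ENNReal.sum_le_tsum _
  calc edist (e (p 0)) (e (p N)) ≤ edist (e (p 0)) (e (p j₀)) + edist (e (p j₀)) (e (p N)) :=
        edist_triangle _ _ _
    _ ≤ _ := by
        rw [two_mul, edist_comm (e (p 0))]
        exact add_le_add hleft hright

/-! ### Visibility of Goldilocks domains -/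

section

variable {d : ℕ} {Ω : Set (EuclideanSpace ℂ (Fin d))}

theorem monotone_kobayashiM (Ω : Set (EuclideanSpace ℂ (Fin d))) : Monotone (kobayashiM Ω) :=
  fun _ _ hrs => iSup₂_mono fun _ _ => iSup_mono' fun h => ⟨⟨h.1, h.2.1.trans hrs, h.2.2⟩, le_rfl⟩

theorem IsBoundedDomain.edist_point_le (hΩ : IsBoundedDomain Ω) {o : KobayashiSpace Ω} {C α : ℝ}
    (hα : 0 < α) (hgrowth : ∀ x : KobayashiSpace Ω,
      rdist o x ≤ C + α * Real.log (1 / bdryDist Ω x.point))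
    {L : ℝ} (hL : 0 < L) (p q : KobayashiSpace Ω) (hpq : rdist p q < L) :
    edist p.point q.point ≤
      ENNReal.ofReal L * kobayashiM Ω (Real.exp ((C + L - rdist o p) / α)) := by
  set M := kobayashiM Ω (Real.exp ((C + L - rdist o p) / α)) with hM
  rcases eq_or_ne M ⊤ with htop | htop
  · rw [htop, ENNReal.mul_top (by simpa using hL)]
    exact le_top
  have hlt : edist p q < ENNReal.ofReal L :=
    (ENNReal.lt_ofReal_iff_toReal_lt (hΩ.edist_ne_top p q)).2 hpq
  obtain ⟨r, hr, hchain⟩ := KobayashiSpace.exists_chain_of_edist_lt hlt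
  have hnorm := hchain.norm_sub_le (c := M.toReal) ENNReal.toReal_nonneg fun s w hs hw v hv => by
    rw [ENNReal.ofReal_toReal htop]
    have hwΩ := hw.right_mem
    refine le_iSup₂_of_le w v (le_iSup_of_le ⟨hwΩ, ?_, hv⟩ le_rfl)
    set z : KobayashiSpace Ω := ⟨w, hwΩ⟩
    have h1 : rdist z p ≤ L := by
      rw [rdist_comm]
      refine ENNReal.toReal_le_of_le_ofReal hL.le ?_
      exact (KobayashiSpace.edist_le_of_chain hw).trans
        (ENNReal.ofReal_le_ofReal (hs.trans hr.le))
    have h2 := rdist_triangle hΩ.edist_ne_top o z p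
    have h3 : rdist o z ≤ C + α * Real.log (1 / bdryDist Ω w) := hgrowth z
    have hnonneg : 0 ≤ bdryDist Ω w := Metric.infDist_nonneg
    -- The value 0 includes the default of `Metric.infDist` for an empty frontier, which occurs in
    -- dimension 0.
    rcases hnonneg.eq_or_lt with h0 | h0
    · rw [← h0]
      exact (Real.exp_pos _).le
    rw [← Real.log_le_iff_le_exp h0, le_div_iff₀ hα]
    rw [one_div, Real.log_inv] at h3
    linarith
  rw [edist_comm, edist_dist, dist_eq_norm, ← ENNReal.ofReal_toReal htop,
    ← ENNReal.ofReal_mul hL.le]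
  refine ENNReal.ofReal_le_ofReal (hnorm.trans ?_)
  rw [mul_comm]
  exact mul_le_mul_of_nonneg_right hr.le ENNReal.toReal_nonneg

/-- Quasi-geodesics of a Goldilocks domain that stay far from a base point have small Euclidean
diameter. -/
theorem IsGoldilocks.visibility (hΩ : IsGoldilocks Ω) (o : KobayashiSpace Ω) {lam kap : ℝ}
    (hlam : 0 < lam) {ε : ℝ≥0∞} (hε : ε ≠ 0) :
    ∃ R : ℝ, ∀ (T : ℝ) (τ : ℝ → KobayashiSpace Ω), 0 ≤ T →
      (∀ s ∈ Icc 0 T, ∀ t ∈ Icc 0 T, rdist (τ s) (τ t) ≤ lam * (|t - s| + kap) ∧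
        (|t - s| - kap) / lam ≤ rdist (τ s) (τ t)) →
      (∀ t ∈ Icc 0 T, R ≤ rdist o (τ t)) → edist (τ 0).point (τ T).point ≤ ε := by
  obtain ⟨r₀, hr₀, hint⟩ := hΩ.integral_lt_top
  obtain ⟨C, α, -, hα, hgrowth⟩ := hΩ.growth o
  -- Samples at times at most 1 apart are within `lam * (1 + kap)`; the absolute value and the added
  -- 1 give positivity and strictness.
  set L : ℝ := |lam * (1 + kap)| + 1 with hLdef
  have hL : 0 < L := by positivity
  set m : ℝ → ℝ≥0∞ := fun ρ => kobayashiM Ω (Real.exp ((C + L - ρ) / α)) with hm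
  have hanti : Antitone m := fun ρ ρ' h => monotone_kobayashiM Ω <| Real.exp_le_exp.2 <|
    div_le_div_of_nonneg_right (by linarith) hα.le
  -- The extra 1 pays for truncation: for `i ≤ N` the sample time `min i T` can fall short of `i` by
  -- less than 1.
  set κ := 1 + kap with hκ
  -- Per sample the lower bound on the distance grows by `1 / (2 * lam)`, so the bound on the
  -- boundary distance shrinks by this factor.
  set q := Real.exp (-(1 / (2 * lam * α))) with hqdef
  have hq : 0 < q := Real.exp_pos _
  have hq1 : q < 1 := by
    rw [hqdef, Real.exp_lt_one_iff, neg_lt_zero]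
    positivity
  set A := Real.exp ((C + L + κ / (2 * lam)) / α) with hA
  obtain ⟨J, hJ⟩ := exists_tsum_mul_pow_ne_top (monotone_kobayashiM Ω) hr₀ hint.ne hq hq1 A
  have hterm : ∀ i : ℕ, m ((i - κ) / (2 * lam)) = kobayashiM Ω (A * q ^ i) := fun i => by
    have : (C + L - (i - κ) / (2 * lam)) / α =
        (C + L + κ / (2 * lam)) / α + i * -(1 / (2 * lam * α)) := by
      field_simp
      ring
    simp only [hm]
    rw [hA, hqdef, ← Real.exp_nat_mul, ← Real.exp_add, this]
  have hsum : ∑' i : ℕ, m (((i + J : ℕ) - κ) / (2 * lam)) ≠ ⊤ := by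
    simpa only [hterm] using hJ
  have hε' : ε / (2 * ENNReal.ofReal L) ≠ 0 := ENNReal.div_ne_zero.2 ⟨hε, by finiteness⟩
  obtain ⟨R, hR⟩ := exists_tsum_max_le (u := fun i : ℕ => (i - κ) / (2 * lam)) hanti J hsum hε'
  refine ⟨R, fun T τ hT hτ hfar => ?_⟩
  set N := ⌈T⌉₊ with hN
  have hNT : T ≤ N := Nat.le_ceil T
  have hNT' : (N : ℝ) < T + 1 := Nat.ceil_lt_add_one hT
  have hmem : ∀ i : ℕ, min (i : ℝ) T ∈ Icc 0 T := fun i =>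
    ⟨le_min (Nat.cast_nonneg i) hT, min_le_right _ _⟩
  have key := edist_le_of_quasiGeodesic_seq (R := R) (κ := κ) hΩ.toIsBoundedDomain.edist_ne_top
    KobayashiSpace.point o hanti
    (fun p q h => hΩ.toIsBoundedDomain.edist_point_le hα hgrowth hL p q h) hlam
    (p := fun i => τ (min (i : ℝ) T)) (N := N) ?_ ?_ fun i _ => hfar _ (hmem i)
  · simp only [Nat.cast_zero, min_eq_left hT, min_eq_right hNT] at key
    refine key.trans ?_
    rw [← mul_assoc]
    exact (mul_le_mul_right hR _).trans ENNReal.mul_div_le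
  · intro i hi j hij
    refine le_trans ?_ (hτ _ (hmem i) _ (hmem (i + j))).2
    refine div_le_div_of_nonneg_right ?_ hlam.le
    have h1 : ((i + j : ℕ) : ℝ) - 1 ≤ min ((i + j : ℕ) : ℝ) T := by
      have : ((i + j : ℕ) : ℝ) ≤ N := by exact_mod_cast hij
      exact le_min (by linarith) (by linarith)
    have h2 := min_le_left (i : ℝ) T
    have h3 := le_abs_self (min ((i + j : ℕ) : ℝ) T - min (i : ℝ) T)
    push_cast at h1 h3 ⊢
    linarith
  · intro i _
    refine ((hτ _ (hmem i) _ (hmem (i + 1))).1.trans ?_).trans_lt (lt_add_one _)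
    refine le_trans ?_ (le_abs_self _)
    refine mul_le_mul_of_nonneg_left ?_ hlam.le
    have : |min ((i + 1 : ℕ) : ℝ) T - min (i : ℝ) T| ≤ 1 := by
      refine (abs_min_sub_min_le_max _ _ _ _).trans ?_
      simp
    linarith

variable {X : Type*} [PseudoEMetricSpace X]

/-- Quasi-isometric embeddings into a Goldilocks domain map geodesics that stay far from a base
point to curves of small Euclidean diameter. -/
theorem IsGoldilocks.edist_le_of_geodesic (hΩ : IsGoldilocks Ω) {F : X → KobayashiSpace Ω}
    (hF : IsQuasiIsometricEmbedding F) (o : X) {ε : ℝ≥0∞} (hε : ε ≠ 0) :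
    ∃ R : ℝ, ∀ (a b : ℝ) (σ : ℝ → X), a ≤ b → IsGeodesicOn σ a b →
      (∀ t ∈ Icc a b, R ≤ rdist o (σ t)) →
      edist (F (σ a)).point (F (σ b)).point ≤ ε := by
  obtain ⟨lam, kap, hlam, -, hqi⟩ := hF
  have hlam0 : 0 < lam := by linarith
  have hup : ∀ x y, rdist (F x) (F y) ≤ lam * (rdist x y + kap) := fun x y => by
    have := (hqi x y).1
    rw [one_div_mul_eq_div, sub_le_iff_le_add, div_le_iff₀ hlam0] at this
    linarith
  have hlow : ∀ x y, (rdist x y - kap) / lam ≤ rdist (F x) (F y) := fun x y => by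
    rw [div_le_iff₀ hlam0]
    linarith [(hqi x y).2]
  obtain ⟨R, hR⟩ := hΩ.visibility (F o) (kap := kap) hlam0 hε
  -- Distance at least `lam * R + kap` from `o` gives distance at least `R` from `F o` in the image.
  refine ⟨lam * R + kap, fun a b σ hab hσ hfar => ?_⟩
  have hmem : ∀ t ∈ Icc 0 (b - a), a + t ∈ Icc a b := fun t ht =>
    ⟨by linarith [ht.1], by linarith [ht.2]⟩
  have := hR (b - a) (fun t => F (σ (a + t))) (by linarith) (fun s hs t ht => by
      have h := hσ.rdist_eq (hmem s hs) (hmem t ht)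
      rw [add_sub_add_left_eq_sub] at h
      rw [← h]
      exact ⟨hup _ _, hlow _ _⟩) fun t ht => by
    refine le_trans ?_ (hlow o _)
    rw [le_div_iff₀ hlam0]
    linarith [hfar _ (hmem t ht)]
  simpa using this

end

/-! ### Extension to compactifications -/

section

variable {X Z : Type*} [PseudoEMetricSpace X] [MetricSpace Z] [CompactSpace Z] {f : X → Z}

theorem IsGoodCompactification.exists_tendsto {Y : Type*} [TopologicalSpace Y]
    [FrechetUrysohnSpace Y] {ι : X → Y} (hι : IsGoodCompactification ι) (hf : Continuous f)
    (hgeo : ∀ (o : X) (ε : ℝ), 0 < ε → ∃ R : ℝ, ∀ (a b : ℝ) (σ : ℝ → X), a ≤ b →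
      IsGeodesicOn σ a b → (∀ t ∈ Icc a b, R ≤ rdist o (σ t)) → dist (f (σ a)) (f (σ b)) ≤ ε)
    (ξ : Y) : ∃ c, Tendsto f (comap ι (𝓝 ξ)) (𝓝 c) := by
  by_cases hξ : ξ ∈ range ι
  · obtain ⟨x, rfl⟩ := hξ
    refine ⟨f x, ?_⟩
    rw [← hι.isOpenEmbedding.isInducing.nhds_eq_comap]
    exact hf.tendsto x
  have hfin := hι.isGeodesicSpace.edist_ne_top
  have hdist : ∀ u v : ℕ → X, Tendsto (fun n => ι (u n)) atTop (𝓝 ξ) →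
      Tendsto (fun n => ι (v n)) atTop (𝓝 ξ) →
      Tendsto (fun n => dist (f (u n)) (f (v n))) atTop (𝓝 0) := by
    intro u v hu hv
    choose T σ hT hσ hσ0 hσT using fun n => hι.isGeodesicSpace (u n) (v n)
    refine Metric.tendsto_atTop.2 fun ε hε => ?_
    obtain ⟨R, hR⟩ := hgeo (u 0) (ε / 2) (half_pos hε)
    have hlim := hι.liminf_eq_top (fun _ => 0) T σ hT hσ ξ hξ (by simpa only [hσ0] using hu)
      (by simpa only [hσT] using hv) (u 0)
    have hlt : ENNReal.ofReal R <
        liminf (fun n => Metric.infEDist (u 0) (σ n '' Icc 0 (T n))) atTop := by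
      rw [hlim]
      exact ENNReal.ofReal_lt_top
    obtain ⟨N, hN⟩ := eventually_atTop.1 (eventually_lt_of_lt_liminf hlt)
    refine ⟨N, fun n hn => ?_⟩
    have h1 := hR 0 (T n) (σ n) (hT n) (hσ n) fun t ht =>
      (ENNReal.ofReal_le_iff_le_toReal (hfin _ _)).1
        ((hN n hn).le.trans (Metric.infEDist_le_edist_of_mem (mem_image_of_mem _ ht)))
    rw [hσ0, hσT] at h1
    rw [Real.dist_eq, sub_zero, abs_of_nonneg dist_nonneg]
    linarith
  obtain ⟨u, hu, huξ⟩ := mem_closure_iff_seq_limit.1 (hι.denseRange ξ)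
  choose u' hu' using hu
  obtain ⟨c, φ, hφ, hc⟩ := CompactSpace.tendsto_subseq fun n => f (u' n)
  have hw : Tendsto (fun n => ι (u' (φ n))) atTop (𝓝 ξ) := by
    simpa only [hu', Function.comp_def] using huξ.comp hφ.tendsto_atTop
  refine ⟨c, ?_⟩
  by_contra hnot
  obtain ⟨U, hU, hUf⟩ : ∃ U ∈ 𝓝 c, f ⁻¹' U ∉ comap ι (𝓝 ξ) := by
    simpa [Filter.tendsto_def] using hnot
  -- If `c` were not the limit, points with image outside `U` would accumulate at `ξ`. A sequence of
  -- them tending to `ξ` must have images tending to `c`, a contradiction.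
  have hcl : ξ ∈ closure (ι '' (f ⁻¹' U)ᶜ) := by
    refine mem_closure_iff_nhds.2 fun V hV => ?_
    by_contra hemp
    refine hUf (mem_comap.2 ⟨V, hV, fun x hx => ?_⟩)
    by_contra hx'
    exact hemp ⟨ι x, hx, x, hx', rfl⟩
  obtain ⟨v, hv, hvξ⟩ := mem_closure_iff_seq_limit.1 hcl
  choose v' hv' hvι using hv
  have hlim : Tendsto (fun n => f (v' n)) atTop (𝓝 c) :=
    Tendsto.congr_dist hc (hdist _ _ hw (by simpa only [hvι] using hvξ))
  obtain ⟨n, hn⟩ := (hlim.eventually hU).exists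
  exact hv' n hn

theorem eventually_lt_gromovProduct {o : X} {x y : ℕ → X} {R : ℝ}
    (h : ENNReal.ofReal R < gromovLiminf o x y) :
    ∀ᶠ p : ℕ × ℕ in atTop, R < gromovProduct o (x p.1) (y p.2) := by
  filter_upwards [eventually_lt_of_lt_liminf h] with p hp
  exact lt_of_not_ge fun hle => hp.not_ge (ENNReal.ofReal_le_ofReal hle)

/-- The double-index `liminf` makes images Cauchy along a sequence converging at infinity and
asymptotic along related sequences. `Quot.lift` needs agreement only on the generating relation, so
its transitivity plays no role. -/
theorem GromovCompactification.exists_tendsto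
    (hprod : ∀ (o : X) (ε : ℝ), 0 < ε → ∃ R : ℝ, ∀ x y : X, R ≤ gromovProduct o x y →
      dist (f x) (f y) ≤ ε) (p : GromovCompactification X) :
    ∃ c, ∀ x ∈ p.reps, Tendsto (fun n => f (x n)) atTop (𝓝 c) := by
  have hev : ∀ x y : ℕ → X, (∀ o, gromovLiminf o x y = ⊤) → ∀ ε > 0,
      ∀ᶠ p : ℕ × ℕ in atTop, dist (f (x p.1)) (f (y p.2)) < ε := by
    intro x y hxy ε hε
    obtain ⟨R, hR⟩ := hprod (x 0) (ε / 2) (half_pos hε)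
    filter_upwards [eventually_lt_gromovProduct
      ((hxy (x 0)).symm ▸ ENNReal.ofReal_lt_top : ENNReal.ofReal R < _)] with p hp
    linarith [hR _ _ hp.le]
  have hlim : ∀ x : {x : ℕ → X // ConvergesAtInfinity x},
      ∃ c, Tendsto (fun n => f (x.1 n)) atTop (𝓝 c) := fun x => by
    refine cauchySeq_tendsto_of_complete (Metric.cauchySeq_iff.2 fun ε hε => ?_)
    obtain ⟨⟨N, N'⟩, hN⟩ := eventually_atTop.1 (hev x.1 x.1 x.2 ε hε)
    exact ⟨max N N', fun i hi j hj =>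
      hN (i, j) ⟨le_of_max_le_left hi, le_of_max_le_right hj⟩⟩
  choose g hg using hlim
  cases p with
  | point x =>
    refine ⟨f x, fun y hy => ?_⟩
    rw [show y = fun _ => x from hy]
    exact tendsto_const_nhds
  | boundary ξ =>
    let G : GromovBoundary X → Z := Quot.lift g fun x y hxy => by
      refine tendsto_nhds_unique (hg x) (Tendsto.congr_dist (hg y) ?_)
      refine Metric.tendsto_atTop.2 fun ε hε => ?_
      obtain ⟨⟨N, N'⟩, hN⟩ := eventually_atTop.1 (hev x.1 y.1 hxy ε hε)
      refine ⟨max N N', fun i hi => ?_⟩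
      rw [Real.dist_eq, sub_zero, abs_of_nonneg dist_nonneg, dist_comm]
      exact hN (i, i) ⟨le_of_max_le_left hi, le_of_max_le_right hi⟩
    refine ⟨G ξ, fun x ⟨hx, hxξ⟩ => ?_⟩
    rw [← hxξ]
    exact hg ⟨x, hx⟩

theorem GromovCompactification.exists_continuous_extension (hf : Continuous f)
    (hprod : ∀ (o : X) (ε : ℝ), 0 < ε → ∃ R : ℝ, ∀ x y : X, R ≤ gromovProduct o x y →
      dist (f x) (f y) ≤ ε) :
    ∃ Ft : GromovCompactification X → Z, Continuous Ft ∧ ∀ x, Ft (.point x) = f x := by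
  choose Ft hFt using GromovCompactification.exists_tendsto hprod
  have hpt : ∀ x, Ft (.point x) = f x := fun x =>
    tendsto_nhds_unique (hFt (.point x) (fun _ => x) rfl) tendsto_const_nhds
  refine ⟨Ft, continuous_def.2 fun U hU => ⟨?_, fun ξ hξ o => ?_⟩, hpt⟩
  · simp only [mem_preimage, hpt]
    exact hU.preimage hf
  · obtain ⟨ε, hε, hball⟩ := Metric.isOpen_iff.1 hU _ hξ
    obtain ⟨R, hR⟩ := hprod o (ε / 2) (half_pos hε)
    refine ⟨R, fun p hp => hball ?_⟩
    -- The extended product is a supremum, so exceeding `R` is witnessed by one pair of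
    -- representatives, and any representatives compute the values of `Ft`.
    simp only [mem_ofPred_eq, GromovCompactification.product, lt_iSup_iff] at hp
    obtain ⟨x, hx, y, hy, hxy⟩ := hp
    have hlim : Tendsto (fun n : ℕ × ℕ => dist (f (x n.1)) (f (y n.2))) atTop
        (𝓝 (dist (Ft p) (Ft (.boundary ξ)))) := by
      rw [← prod_atTop_atTop_eq]
      exact ((hFt p x hx).comp tendsto_fst).dist ((hFt _ y hy).comp tendsto_snd)
    have hle : dist (Ft p) (Ft (.boundary ξ)) ≤ ε / 2 := le_of_tendsto hlim <|
      (eventually_lt_gromovProduct hxy).mono fun n hn => hR _ _ hn.le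
    rw [Metric.mem_ball]
    linarith

end

theorem theorem5 {k d : ℕ} (D : Set (EuclideanSpace ℂ (Fin k))) (hD : IsBoundedDomain D)
    (Ω : Set (EuclideanSpace ℂ (Fin d))) (hΩ : IsGoldilocks Ω)
    (F : KobayashiSpace D → KobayashiSpace Ω) (hF : Continuous F)
    (hqi : IsQuasiIsometricEmbedding F) :
    (∀ (Dstar : Type*) [TopologicalSpace Dstar] [FrechetUrysohnSpace Dstar]
      (ι : KobayashiSpace D → Dstar), IsGoodCompactification ι →
        ∃ Ft : Dstar → closure Ω, Continuous Ft ∧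
          ∀ x : KobayashiSpace D, (Ft (ι x) : EuclideanSpace ℂ (Fin d)) = (F x).point) ∧
    (IsProperMetric (KobayashiSpace D) → IsGeodesicSpace (KobayashiSpace D) →
      IsGromovHyperbolic (KobayashiSpace D) →
        ∃ Ft : GromovCompactification (KobayashiSpace D) → closure Ω, Continuous Ft ∧
          ∀ x : KobayashiSpace D,
            (Ft (.point x) : EuclideanSpace ℂ (Fin d)) = (F x).point) := by
  have : CompactSpace (closure Ω) := isCompact_iff_compactSpace.1 hΩ.isBounded.isCompact_closure
  let f : KobayashiSpace D → closure Ω := fun x => ⟨(F x).point, subset_closure (F x).mem⟩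
  have hf : Continuous f :=
    ((KobayashiSpace.continuous_point hΩ.isBounded).comp hF).subtype_mk _
  have hgeo : ∀ (o : KobayashiSpace D) (ε : ℝ), 0 < ε → ∃ R : ℝ, ∀ (a b : ℝ)
      (σ : ℝ → KobayashiSpace D), a ≤ b → IsGeodesicOn σ a b →
      (∀ t ∈ Icc a b, R ≤ rdist o (σ t)) → dist (f (σ a)) (f (σ b)) ≤ ε := by
    intro o ε hε
    obtain ⟨R, hR⟩ := hΩ.edist_le_of_geodesic hqi o (ENNReal.ofReal_pos.2 hε).ne'
    exact ⟨R, fun a b σ hab hσ hfar => (edist_le_ofReal hε.le).1 (hR a b σ hab hσ hfar)⟩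
  refine ⟨fun Dstar _ _ ι hι => ?_, fun _ hgs _ => ?_⟩
  · have hdi : IsDenseInducing ι := ⟨hι.isOpenEmbedding.isInducing, hι.denseRange⟩
    have hlim := hι.exists_tendsto hf hgeo
    exact ⟨hdi.extend f, hdi.continuous_extend hlim, fun x =>
      congrArg Subtype.val (hdi.extend_eq hf x)⟩
  · obtain ⟨Ft, hFt, hpt⟩ := GromovCompactification.exists_continuous_extension hf
      fun o ε hε => by
        obtain ⟨R, hR⟩ := hgeo o ε hε
        refine ⟨R, fun x y hxy => ?_⟩
        obtain ⟨T, σ, hT, hσ, rfl, rfl⟩ := hgs x y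
        exact hR 0 T σ hT hσ fun t ht =>
          hxy.trans (hσ.gromovProduct_le hgs.edist_ne_top ht o)
    exact ⟨Ft, hFt, fun x => congrArg Subtype.val (hpt x)⟩
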